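/- There is an absolute constant $C>0$ with the following property. Let $N\ge 1$ and let $x_1,\dots,x_N$ be points (repetitions allowed) of the flat torus $\mathbb{T}^2=\mathbb{R}^2/\mathbb{Z}^2$, normalized to have area $1$, and let $\|x-y\|$ denote the distance on $\mathbb{T}^2$, i.e. the minimum of the Euclidean lengths $|x-y+k|$ over $k\in\mathbb{Z}^2$. Then there exists a disk $D\subset\mathbb{T}^2$ of radius $1/4$ or $1/2$, with area $|D|$, such that $$\left|\#\{1\le i\le N: x_i\in D\}-N|D|\right|\;\ge\; C\left(N^{-3/2}\sum_{i,j=1}^{N}\frac{N}{1+N^2\|x_i-x_j\|^4}\right)^{1/2},$$ and the inequality holds for this disk both with and without its boundary circle. The sum runs over all pairs $(i,j)$, including $i=j$. -/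

import Mathlib

open MeasureTheory

noncomputable section

/-- The flat torus `(ℝ/ℤ)²`. Its `volume` is the product of the Haar measures of total mass `1`. -/
abbrev Torus2 : Type := UnitAddTorus (Fin 2)

/-- The flat (Euclidean) distance on the torus: the norm of a coordinate difference in `ℝ/ℤ` is its
distance to the nearest integer, so this is the least Euclidean length `|x - y + k|`, `k ∈ ℤ²`. -/
def torusDist (x y : Torus2) : ℝ := Real.sqrt (‖x 0 - y 0‖ ^ 2 + ‖x 1 - y 1‖ ^ 2)

/-- The closed disk with center `c` and radius `r`. -/
def closedDisk (c : Torus2) (r : ℝ) : Set Torus2 := {y | torusDist y c ≤ r}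

/-- The open disk with center `c` and radius `r`. -/
def openDisk (c : Torus2) (r : ℝ) : Set Torus2 := {y | torusDist y c < r}

/-- `|#{i : xᵢ ∈ D} - N |D||`, where `|D|` is the area of `D`. -/
def discrepancy {N : ℕ} (x : Fin N → Torus2) (D : Set Torus2) : ℝ :=
  |(Set.ncard {i : Fin N | x i ∈ D} : ℝ) - N * (volume : Measure Torus2).real D|

/-- The energy `∑_{i,j} N / (1 + N² ‖xᵢ - xⱼ‖⁴)`, over all pairs, the diagonal included. -/
def rieszEnergy {N : ℕ} (x : Fin N → Torus2) : ℝ :=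
  ∑ i : Fin N, ∑ j : Fin N, (N : ℝ) / (1 + (N : ℝ) ^ 2 * torusDist (x i) (x j) ^ 4)

end

/-! The bound comes from the mean square of the discrepancy over all centers. By Parseval this mean
is a sum over frequencies k; for k ≠ 0 the term is |S(k)|² times the squared Fourier coefficient of
the disk, where S(k) = ∑ e(k·x_i). The disk coefficient is 4r² `chordIntegral` (2π|k|r), a Bessel
function of size |k|^(-3/2) that oscillates, so one radius can miss frequencies near its zeros. The
radii 1/4 and 1/2 cover for each other: the leading term at u is proportional to sin u - cos u, and
where that vanishes sin 2u - cos 2u = 1. Hence the two squared coefficients add up to at least a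
constant times |k|^(-3) (`chordIntegral_sq_add_sq_ge`).

The energy is compared with a positive-definite sum. A product of two Poisson kernels with 1 - ρ =
1/(2√N) majorizes N/(1 + N²‖y‖⁴) up to a constant (`poissonKer_mul_ge`), and its sum E over pairs
equals ∑ ρ^(|k₀|+|k₁|) |S(k)|². The exponential weight is at most a constant times N^(3/2) |k|^(-3)
(`pow_mul_cube_le`), so the terms k ≠ 0 are bounded by N^(3/2) times the two mean squares. The term
k = 0 is N², and the diagonal alone gives E ≥ 4N², so it is absorbed (`rieszEnergy_le`).

Some center does at least as well as the mean, and it can avoid the null set of centers whose circle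
meets a point, so open and closed disks agree. -/

/-! ### Asymptotics of the Bessel-type integral by contour shift -/

/-- The principal square root has nonnegative real part. -/
theorem re_cpow_two_inv_nonneg (w : ℂ) : 0 ≤ (w ^ (2⁻¹ : ℂ)).re := by
  rcases eq_or_ne w 0 with rfl | hw
  · simp
  · rw [Complex.cpow_def_of_ne_zero hw, Complex.exp_re]
    refine mul_nonneg (Real.exp_pos _).le (Real.cos_nonneg_of_mem_Icc ?_)
    have h1 := Complex.neg_pi_lt_arg w
    have h2 := Complex.arg_le_pi w
    have : (Complex.log w * 2⁻¹).im = w.arg / 2 := by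
      rw [show (2⁻¹ : ℂ) = ((2⁻¹ : ℝ) : ℂ) by simp, Complex.im_mul_ofReal, Complex.log_im]
      ring
    rw [this]
    constructor <;> linarith

theorem sq_cpow_two_inv (w : ℂ) : (w ^ (2⁻¹ : ℂ)) ^ 2 = w := by
  simp

theorem ofReal_cpow_two_inv {t : ℝ} (ht : 0 ≤ t) : (t : ℂ) ^ (2⁻¹ : ℂ) = (√t : ℝ) := by
  rw [Real.sqrt_eq_rpow, Complex.ofReal_cpow ht]
  norm_num

/-- `√(s² - 2is) = √s (1 - i) + O(s^{3/2})`, explicitly. -/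
theorem norm_cpow_two_inv_sub_le {s : ℝ} (hs : 0 ≤ s) :
    ‖((s : ℂ) ^ 2 - 2 * s * Complex.I) ^ (2⁻¹ : ℂ) - √s * (1 - Complex.I)‖
      ≤ s * √s / (2 * √2) := by
  rcases hs.eq_or_lt with rfl | hs
  · simp
  set q := ((s : ℂ) ^ 2 - 2 * s * Complex.I) ^ (2⁻¹ : ℂ) with hq
  have hq2 : q ^ 2 = (s : ℂ) ^ 2 - 2 * s * Complex.I := sq_cpow_two_inv _
  have hre : 0 ≤ q.re := re_cpow_two_inv_nonneg _
  set σ := √s with hσ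
  have hσp : 0 < σ := Real.sqrt_pos.2 hs
  have hσ2 : σ ^ 2 = s := Real.sq_sqrt hs.le
  have h2 : √2 ^ 2 = (2 : ℝ) := Real.sq_sqrt (by norm_num)
  have h2p : 0 < √2 := by positivity
  have him : q.re * q.im = - s := by
    have := congrArg Complex.im hq2
    simp [pow_two] at this
    linarith
  have hrep : 0 < q.re := by
    rcases hre.eq_or_lt with h | h
    · rw [← h] at him; simp at him; linarith
    · exact h
  have himn : q.im < 0 := by nlinarith
  -- With a = σ(1 - i) one has a² = -2is, so (q - a)(q + a) = q² - a² = s².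
  have hfac : ‖q - σ * (1 - Complex.I)‖ * ‖q + σ * (1 - Complex.I)‖ = s ^ 2 := by
    rw [← norm_mul]
    have : (q - σ * (1 - Complex.I)) * (q + σ * (1 - Complex.I)) = ((s ^ 2 : ℝ) : ℂ) := by
      have hc : (σ : ℂ) ^ 2 = s := by exact_mod_cast hσ2
      have : (q - σ * (1 - Complex.I)) * (q + σ * (1 - Complex.I))
        = q ^ 2 - (σ : ℂ) ^ 2 * (1 - 2 * Complex.I + Complex.I ^ 2) := by ring
      rw [this, hq2, hc, Complex.I_sq]; push_cast; ring
    rw [this, Complex.norm_real, Real.norm_of_nonneg (by positivity)]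
  -- Both q and a lie in the fourth quadrant, so nothing cancels in q + a.
  have hlow : 2 * √2 * σ ≤ ‖q + σ * (1 - Complex.I)‖ := by
    refine le_of_sq_le_sq ?_ (norm_nonneg _)
    rw [Complex.sq_norm, Complex.normSq_apply]
    have e1 : (q + σ * (1 - Complex.I)).re = q.re + σ := by simp
    have e2 : (q + σ * (1 - Complex.I)).im = q.im - σ := by simp; ring
    rw [e1, e2, mul_pow, mul_pow, h2, hσ2]
    have h3 : 2 * σ ≤ q.re - q.im := by
      refine le_of_sq_le_sq ?_ (by linarith)
      nlinarith [sq_nonneg (q.re + q.im)]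
    nlinarith [sq_nonneg (q.re + q.im), mul_le_mul_of_nonneg_left h3 hσp.le]
  rw [le_div_iff₀ (by positivity)]
  have : ‖q - σ * (1 - Complex.I)‖ * (2 * √2 * σ) ≤ s ^ 2 :=
    hfac ▸ mul_le_mul_of_nonneg_left hlow (norm_nonneg _)
  have h4 : s ^ 2 = (s * σ) * σ := by rw [← hσ2]; ring
  rw [h4] at this
  refine le_of_mul_le_mul_right ?_ hσp
  linarith

/-- `∫₀¹ √(1 - t²) cos (u t) dt`, which is `π J₁(u) / (2u)`. -/
noncomputable def chordIntegral (u : ℝ) : ℝ := ∫ t in (0 : ℝ)..1, √(1 - t ^ 2) * Real.cos (u * t)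

/-- On the closed rectangle Re(1 - z²) = 1 - x² + y² ≥ 0, with equality only at the branch point z =
1, where the square root is still continuous. -/
theorem continuousOn_cpow_mul_exp (u R : ℝ) :
    ContinuousOn (fun z : ℂ ↦ (1 - z ^ 2) ^ (2⁻¹ : ℂ) * Complex.exp (Complex.I * u * z))
      (Set.Icc 0 1 ×ℂ Set.Icc 0 R) := by
  refine ContinuousOn.mul (fun z hz ↦ ?_) (by fun_prop)
  refine ContinuousAt.continuousWithinAt ?_
  have h0 : 0 ≤ (1 - z ^ 2).re := by
    obtain ⟨⟨h1, h2⟩, -⟩ := hz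
    simp [pow_two]; nlinarith [mul_self_nonneg z.im]
  exact ContinuousAt.comp (f := fun z : ℂ ↦ 1 - z ^ 2) (x := z)
    (g := fun w : ℂ ↦ w ^ (2⁻¹ : ℂ))
    (Complex.continuousAt_cpow_const_of_re_pos (Or.inl h0) (by norm_num)) (by fun_prop)

theorem differentiableOn_cpow_mul_exp (u R : ℝ) :
    DifferentiableOn ℂ (fun z : ℂ ↦ (1 - z ^ 2) ^ (2⁻¹ : ℂ) * Complex.exp (Complex.I * u * z))
      (Set.Ioo 0 1 ×ℂ Set.Ioo 0 R) := by
  refine DifferentiableOn.mul (fun z hz ↦ ?_) (by fun_prop)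
  refine DifferentiableWithinAt.cpow_const (by fun_prop) (Or.inl ?_)
  obtain ⟨⟨h1, h2⟩, -⟩ := hz
  simp [pow_two]; nlinarith [mul_self_nonneg z.im]

/-- Moving the contour of `chordIntegral` to the vertical line through `1`. -/
theorem chordIntegral_eq_contour (u : ℝ) {R : ℝ} (hR : 0 ≤ R) :
    chordIntegral u =
      (∫ x in (0 : ℝ)..1, (1 - ((x : ℂ) + R * Complex.I) ^ 2) ^ (2⁻¹ : ℂ) *
        Complex.exp (Complex.I * u * (x + R * Complex.I))).re
      - (Complex.I * Complex.exp (Complex.I * u) * ∫ y in (0 : ℝ)..R,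
          ((y : ℂ) ^ 2 - 2 * y * Complex.I) ^ (2⁻¹ : ℂ) * (Real.exp (-(u * y)) : ℂ)).re := by
  have key := Complex.integral_boundary_rect_eq_zero_of_continuousOn_of_differentiableOn
    (fun z : ℂ ↦ (1 - z ^ 2) ^ (2⁻¹ : ℂ) * Complex.exp (Complex.I * u * z)) 0 (1 + R * Complex.I)
    (by simpa [Set.uIcc_of_le, hR] using continuousOn_cpow_mul_exp u R)
    (by simpa [hR] using differentiableOn_cpow_mul_exp u R)
  simp only [Complex.zero_re, Complex.add_re, Complex.one_re, Complex.mul_re, Complex.ofReal_re,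
    Complex.I_re, mul_zero, Complex.ofReal_im, Complex.I_im, mul_one, sub_self, add_zero,
    Complex.zero_im, Complex.ofReal_zero, zero_mul, Complex.add_im, Complex.one_im, Complex.mul_im,
    zero_add, smul_eq_mul, Complex.ofReal_one] at key
  have hb : (∫ x in (0 : ℝ)..1, (1 - (x : ℂ) ^ 2) ^ (2⁻¹ : ℂ) *
      Complex.exp (Complex.I * u * x)).re = chordIntegral u := by
    have : (∫ x in (0 : ℝ)..1, (1 - (x : ℂ) ^ 2) ^ (2⁻¹ : ℂ) * Complex.exp (Complex.I * u * x)) =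
        (∫ x in (0 : ℝ)..1, √(1 - x ^ 2) * Real.cos (u * x) : ℝ) +
        (∫ x in (0 : ℝ)..1, √(1 - x ^ 2) * Real.sin (u * x) : ℝ) * Complex.I := by
      rw [← intervalIntegral.integral_ofReal, ← intervalIntegral.integral_ofReal,
        ← intervalIntegral.integral_mul_const, ← intervalIntegral.integral_add]
      · refine intervalIntegral.integral_congr fun x hx ↦ ?_
        rw [Set.uIcc_of_le zero_le_one] at hx
        have e1 : (1 - (x : ℂ) ^ 2) = ((1 - x ^ 2 : ℝ) : ℂ) := by push_cast; rfl
        have e2 : Complex.I * u * x = ((u * x : ℝ) : ℂ) * Complex.I := by push_cast; ring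
        simp only [e1, e2]
        rw [ofReal_cpow_two_inv (by nlinarith [hx.1, hx.2]), Complex.exp_mul_I,
          ← Complex.ofReal_cos, ← Complex.ofReal_sin]
        push_cast; ring
      · exact Continuous.intervalIntegrable (by fun_prop) _ _
      · exact Continuous.intervalIntegrable (by fun_prop) _ _
    rw [this, chordIntegral]; simp
  -- On the imaginary axis the integrand is real, so after the factor i from dz the left edge has no
  -- real part.
  have hl : (Complex.I * ∫ y in (0 : ℝ)..R, (1 - ((y : ℂ) * Complex.I) ^ 2) ^ (2⁻¹ : ℂ) *
      Complex.exp (Complex.I * u * (y * Complex.I))).re = 0 := by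
    have : (∫ y in (0 : ℝ)..R, (1 - ((y : ℂ) * Complex.I) ^ 2) ^ (2⁻¹ : ℂ) *
      Complex.exp (Complex.I * u * (y * Complex.I))) =
      ((∫ y in (0 : ℝ)..R, √(1 + y ^ 2) * Real.exp (-(u * y)) : ℝ) : ℂ) := by
      rw [← intervalIntegral.integral_ofReal]
      refine intervalIntegral.integral_congr fun y _ ↦ ?_
      have e1 : (1 - ((y : ℂ) * Complex.I) ^ 2) = ((1 + y ^ 2 : ℝ) : ℂ) := by
        rw [mul_pow, Complex.I_sq]; push_cast; ring
      have e2 : Complex.I * u * (y * Complex.I) = ((-(u * y) : ℝ) : ℂ) := by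
        push_cast; linear_combination (u : ℂ) * y * Complex.I_sq
      simp only [e1, e2]
      rw [ofReal_cpow_two_inv (by positivity)]
      push_cast; rfl
    rw [this]; simp
  have hr : (∫ y in (0 : ℝ)..R, (1 - (1 + (y : ℂ) * Complex.I) ^ 2) ^ (2⁻¹ : ℂ) *
      Complex.exp (Complex.I * u * (1 + y * Complex.I))) =
      Complex.exp (Complex.I * u) * ∫ y in (0 : ℝ)..R,
          ((y : ℂ) ^ 2 - 2 * y * Complex.I) ^ (2⁻¹ : ℂ) * (Real.exp (-(u * y)) : ℂ) := by
    rw [← intervalIntegral.integral_const_mul]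
    refine intervalIntegral.integral_congr fun y _ ↦ ?_
    have e1 : (1 - (1 + (y : ℂ) * Complex.I) ^ 2) = (y : ℂ) ^ 2 - 2 * y * Complex.I := by
      linear_combination -(y : ℂ) ^ 2 * Complex.I_sq
    have e2 : Complex.I * u * (1 + y * Complex.I) = Complex.I * u + ((-(u * y) : ℝ) : ℂ) := by
      push_cast; linear_combination (u : ℂ) * y * Complex.I_sq
    simp only [e1, e2, Complex.exp_add, Complex.ofReal_exp]
    ring
  have key' := congrArg Complex.re key
  rw [hr, Complex.sub_re, Complex.add_re, Complex.sub_re, hb, hl, ← mul_assoc] at key'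
  simp only [Complex.zero_re] at key'
  linarith

theorem integral_sqrt_mul_exp {u : ℝ} (hu : 0 < u) :
    ∫ s in Set.Ioi (0 : ℝ), √s * Real.exp (-(u * s)) = √Real.pi / 2 / (u * √u) := by
  have h := Real.integral_rpow_mul_exp_neg_mul_Ioi (a := 1 / 2 + 1) (by norm_num) hu
  rw [Real.Gamma_add_one (by norm_num), Real.Gamma_one_half_eq,
    Real.rpow_add_one (by positivity), ← Real.sqrt_eq_rpow] at h
  have e : ∫ s in Set.Ioi (0 : ℝ), √s * Real.exp (-(u * s))
      = ∫ s in Set.Ioi (0 : ℝ), s ^ ((1 : ℝ) / 2 + 1 - 1) * Real.exp (-(u * s)) := by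
    simp only [add_sub_cancel_right, ← Real.sqrt_eq_rpow]
  rw [e, h, Real.sqrt_div zero_le_one, Real.sqrt_one]
  have : 0 < √u := Real.sqrt_pos.2 hu
  field_simp

theorem integral_mul_sqrt_mul_exp {u : ℝ} (hu : 0 < u) :
    ∫ s in Set.Ioi (0 : ℝ), s * √s * Real.exp (-(u * s))
      = 3 / (2 * u) * (√Real.pi / 2 / (u * √u)) := by
  have h := Real.integral_rpow_mul_exp_neg_mul_Ioi (a := 1 / 2 + 1 + 1) (by norm_num) hu
  rw [Real.Gamma_add_one (by norm_num), Real.Gamma_add_one (by norm_num), Real.Gamma_one_half_eq,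
    Real.rpow_add_one (by positivity), Real.rpow_add_one (by positivity),
    ← Real.sqrt_eq_rpow] at h
  have e : ∫ s in Set.Ioi (0 : ℝ), s * √s * Real.exp (-(u * s))
      = ∫ s in Set.Ioi (0 : ℝ), s ^ ((1 : ℝ) / 2 + 1 + 1 - 1) * Real.exp (-(u * s)) := by
    refine setIntegral_congr_fun measurableSet_Ioi fun s hs ↦ ?_
    have hs : (0 : ℝ) < s := hs
    simp only [add_sub_cancel_right]
    rw [Real.rpow_add_one hs.ne', ← Real.sqrt_eq_rpow, mul_comm s]
  rw [e, h, Real.sqrt_div zero_le_one, Real.sqrt_one]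
  have : 0 < √u := Real.sqrt_pos.2 hu
  field_simp
  norm_num

theorem norm_contour_top_le (u : ℝ) {R : ℝ} (hR : 0 ≤ R) :
    ‖∫ x in (0 : ℝ)..1, (1 - ((x : ℂ) + R * Complex.I) ^ 2) ^ (2⁻¹ : ℂ) *
        Complex.exp (Complex.I * u * (x + R * Complex.I))‖ ≤ (2 + R) * Real.exp (-(u * R)) := by
  refine (intervalIntegral.norm_integral_le_of_norm_le_const (C := (2 + R) * Real.exp (-(u * R)))
    fun x hx ↦ ?_).trans_eq (by simp)
  rw [Set.uIoc_of_le zero_le_one] at hx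
  rw [norm_mul, Complex.norm_exp]
  have e : (Complex.I * u * (x + R * Complex.I)).re = -(u * R) := by simp
  rw [e]
  refine mul_le_mul_of_nonneg_right ?_ (Real.exp_pos _).le
  refine le_of_sq_le_sq ?_ (by linarith)
  rw [← norm_pow, sq_cpow_two_inv]
  have h1 : ‖(x : ℂ) + R * Complex.I‖ ≤ 1 + R := by
    refine (norm_add_le _ _).trans (add_le_add ?_ ?_)
    · rw [Complex.norm_real, Real.norm_of_nonneg hx.1.le]; exact hx.2
    · simp [abs_of_nonneg hR]
  calc ‖1 - ((x : ℂ) + R * Complex.I) ^ 2‖ ≤ 1 + ‖(x : ℂ) + R * Complex.I‖ ^ 2 := by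
        refine (norm_sub_le _ _).trans (by simp)
    _ ≤ 1 + (1 + R) ^ 2 := by gcongr
    _ ≤ (2 + R) ^ 2 := by nlinarith

/-- The one-term asymptotics of `chordIntegral`, with an explicit error. -/
theorem abs_chordIntegral_sub_le {u : ℝ} (hu : 0 < u) :
    |chordIntegral u - (Real.sin u - Real.cos u) * (√Real.pi / 2 / (u * √u))|
      ≤ 3 / (4 * √2 * u) * (√Real.pi / 2 / (u * √u)) := by
  have hpos : 0 < √Real.pi / 2 / (u * √u) := by
    have := Real.pi_pos
    positivity
  have hi1 : IntegrableOn (fun s : ℝ ↦ √s * Real.exp (-(u * s))) (Set.Ioi 0) :=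
    Integrable.of_integral_ne_zero (by rw [integral_sqrt_mul_exp hu]; exact hpos.ne')
  have hi2 : IntegrableOn (fun s : ℝ ↦ s * √s * Real.exp (-(u * s))) (Set.Ioi 0) :=
    Integrable.of_integral_ne_zero (by rw [integral_mul_sqrt_mul_exp hu]; positivity)
  -- At finite height R, the first error is the top edge and the second comes from replacing the
  -- square root by √s(1 - i) on the right edge. The limit R → ∞ removes the first.
  have hbound : ∀ R : ℝ, 0 ≤ R →
      |chordIntegral u - (Real.sin u - Real.cos u) * ∫ s in (0 : ℝ)..R, √s * Real.exp (-(u * s))|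
        ≤ (2 + R) * Real.exp (-(u * R)) + 3 / (4 * √2 * u) * (√Real.pi / 2 / (u * √u)) := by
    intro R hR
    set T := ∫ x in (0 : ℝ)..1, (1 - ((x : ℂ) + R * Complex.I) ^ 2) ^ (2⁻¹ : ℂ) *
        Complex.exp (Complex.I * u * (x + R * Complex.I)) with hT
    set E := ∫ y in (0 : ℝ)..R, (((y : ℂ) ^ 2 - 2 * y * Complex.I) ^ (2⁻¹ : ℂ)
      - √y * (1 - Complex.I)) * (Real.exp (-(u * y)) : ℂ) with hE
    set A := ∫ s in (0 : ℝ)..R, √s * Real.exp (-(u * s)) with hA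
    have hcont : Continuous fun y : ℝ ↦ ((y : ℂ) ^ 2 - 2 * y * Complex.I) ^ (2⁻¹ : ℂ) := by
      refine continuous_iff_continuousAt.2 fun y ↦ ?_
      have h0 : 0 ≤ ((y : ℂ) ^ 2 - 2 * y * Complex.I).re := by
        simp [pow_two]; exact mul_self_nonneg y
      exact ContinuousAt.comp (f := fun y : ℝ ↦ (y : ℂ) ^ 2 - 2 * y * Complex.I) (x := y)
        (g := fun w : ℂ ↦ w ^ (2⁻¹ : ℂ))
        (Complex.continuousAt_cpow_const_of_re_pos (Or.inl h0) (by norm_num)) (by fun_prop)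
    have hsplit : ∫ y in (0 : ℝ)..R,
        ((y : ℂ) ^ 2 - 2 * y * Complex.I) ^ (2⁻¹ : ℂ) * (Real.exp (-(u * y)) : ℂ)
        = E + (1 - Complex.I) * A := by
      rw [hE, hA, ← intervalIntegral.integral_ofReal, ← intervalIntegral.integral_const_mul,
        ← intervalIntegral.integral_add]
      · refine intervalIntegral.integral_congr fun y _ ↦ ?_
        push_cast; ring
      · exact Continuous.intervalIntegrable (by fun_prop) _ _
      · exact Continuous.intervalIntegrable (by fun_prop) _ _
    have hmain : (Complex.I * Complex.exp (Complex.I * u) * ((1 - Complex.I) * A)).re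
        = (Real.cos u - Real.sin u) * A := by
      rw [mul_comm Complex.I (u : ℂ), Complex.exp_mul_I, ← Complex.ofReal_cos,
        ← Complex.ofReal_sin]
      simp
      rw [Complex.sin_ofReal_re, Complex.cos_ofReal_re]; ring
    have hEle : ‖E‖ ≤ 3 / (4 * √2 * u) * (√Real.pi / 2 / (u * √u)) := by
      calc ‖E‖ ≤ ∫ s in (0 : ℝ)..R, (s * √s * Real.exp (-(u * s))) * (1 / (2 * √2)) := by
            refine intervalIntegral.norm_integral_le_of_norm_le hR ?_ ?_
            · refine Filter.Eventually.of_forall fun s hs ↦ ?_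
              rw [norm_mul, Complex.norm_real, Real.norm_of_nonneg (Real.exp_pos _).le]
              refine (mul_le_mul_of_nonneg_right (norm_cpow_two_inv_sub_le hs.1.le)
                (Real.exp_pos _).le).trans_eq (by ring)
            · exact Continuous.intervalIntegrable (by fun_prop) _ _
        _ = (∫ s in Set.Ioc 0 R, s * √s * Real.exp (-(u * s))) * (1 / (2 * √2)) := by
            rw [intervalIntegral.integral_mul_const, intervalIntegral.integral_of_le hR]
        _ ≤ (∫ s in Set.Ioi 0, s * √s * Real.exp (-(u * s))) * (1 / (2 * √2)) := by
            refine mul_le_mul_of_nonneg_right ?_ (by positivity)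
            refine setIntegral_mono_set hi2 ?_ Set.Ioc_subset_Ioi_self.eventuallyLE
            refine (ae_restrict_iff' measurableSet_Ioi).2 (Filter.Eventually.of_forall fun s hs ↦ ?_)
            have : (0 : ℝ) < s := hs
            simp only [Pi.zero_apply]; positivity
        _ = _ := by rw [integral_mul_sqrt_mul_exp hu]; field_simp; norm_num
    have hTle : ‖T‖ ≤ (2 + R) * Real.exp (-(u * R)) := norm_contour_top_le u hR
    have hsum : chordIntegral u - (Real.sin u - Real.cos u) * A
        = T.re - (Complex.I * Complex.exp (Complex.I * u) * E).re := by
      rw [chordIntegral_eq_contour u hR, ← hT, hsplit, mul_add, Complex.add_re, hmain]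
      ring
    have hE' : |(Complex.I * Complex.exp (Complex.I * u) * E).re| ≤ ‖E‖ := by
      refine (Complex.abs_re_le_norm _).trans_eq ?_
      rw [norm_mul, norm_mul, mul_comm Complex.I (u : ℂ), Complex.norm_exp_ofReal_mul_I]
      simp
    rw [hsum]
    refine (abs_sub _ _).trans (add_le_add ?_ (hE'.trans hEle))
    exact (Complex.abs_re_le_norm _).trans hTle
  have hlim1 : Filter.Tendsto (fun R : ℝ ↦ |chordIntegral u - (Real.sin u - Real.cos u) *
      ∫ s in (0 : ℝ)..R, √s * Real.exp (-(u * s))|) Filter.atTop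
      (nhds |chordIntegral u - (Real.sin u - Real.cos u) * (√Real.pi / 2 / (u * √u))|) := by
    rw [← integral_sqrt_mul_exp hu]
    exact ((intervalIntegral_tendsto_integral_Ioi 0 hi1 Filter.tendsto_id).const_mul _).const_sub
      _ |>.abs
  have hlim2 : Filter.Tendsto (fun R : ℝ ↦ (2 + R) * Real.exp (-(u * R)) +
      3 / (4 * √2 * u) * (√Real.pi / 2 / (u * √u))) Filter.atTop
      (nhds (0 + 3 / (4 * √2 * u) * (√Real.pi / 2 / (u * √u)))) := by
    refine Filter.Tendsto.add_const _ ?_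
    have h1 := (Real.tendsto_pow_mul_exp_neg_atTop_nhds_zero 1).comp
      (Filter.tendsto_id.const_mul_atTop hu)
    have h0 := (Real.tendsto_pow_mul_exp_neg_atTop_nhds_zero 0).comp
      (Filter.tendsto_id.const_mul_atTop hu)
    have := (h0.const_mul 2).add (h1.const_mul u⁻¹)
    simp only [mul_zero, add_zero] at this
    refine this.congr fun R ↦ ?_
    simp only [Function.comp, id, pow_zero, pow_one, one_mul]
    field_simp
  rw [zero_add] at hlim2
  refine le_of_tendsto_of_tendsto hlim1 hlim2 ?_
  filter_upwards [Filter.eventually_ge_atTop 0] with R hR using hbound R hR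

/-- `J₁` has no common zeros with its dilate by `2`, quantitatively. -/
theorem chordIntegral_sq_add_sq_ge {u : ℝ} (hu : Real.pi / 2 ≤ u) :
    1 / 10000 / u ^ 3 ≤ chordIntegral u ^ 2 + chordIntegral (2 * u) ^ 2 := by
  have hpi := Real.pi_gt_three
  have hu0 : 0 < u := by linarith
  have h2 : √2 ^ 2 = (2 : ℝ) := Real.sq_sqrt (by norm_num)
  have h2a : 1.41 ≤ √2 := Real.le_sqrt_of_sq_le (by norm_num)
  have h2b : √2 ≤ 1.42 := Real.sqrt_le_iff.2 (by norm_num)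
  have hg : ∀ v : ℝ, 0 < v → (√Real.pi / 2 / (v * √v)) ^ 2 = Real.pi / 4 / v ^ 3 := by
    intro v hv
    rw [div_pow, div_pow, mul_pow, Real.sq_sqrt hv.le, Real.sq_sqrt (by linarith)]
    ring
  -- Here e bounds the relative error of the asymptotics and m is what remains of |sin v - cos v|;
  -- the factor 3/4 is π/4 with π > 3.
  have hlow : ∀ v m e c : ℝ, 0 < v → 0 ≤ m → 3 / (4 * √2 * v) ≤ e →
      e + m ≤ |Real.sin v - Real.cos v| → c ≤ m ^ 2 * (3 / 4) →
      c / v ^ 3 ≤ chordIntegral v ^ 2 := by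
    intro v m e c hv hm he hs hc
    have hgv := hg v hv
    have hb := abs_chordIntegral_sub_le hv
    have hgp : 0 < √Real.pi / 2 / (v * √v) := by positivity
    set g := √Real.pi / 2 / (v * √v)
    have h1 : (e + m) * g ≤ |(Real.sin v - Real.cos v) * g| := by
      rw [abs_mul, abs_of_pos hgp]; gcongr
    have h3 : 3 / (4 * √2 * v) * g ≤ e * g := by gcongr
    have h4 := abs_sub_abs_le_abs_sub ((Real.sin v - Real.cos v) * g) (chordIntegral v)
    rw [abs_sub_comm] at h4
    have h5 : m * g ≤ |chordIntegral v| := by linarith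
    calc c / v ^ 3 ≤ (m ^ 2 * (3 / 4)) / v ^ 3 := by gcongr
      _ ≤ m ^ 2 * (Real.pi / 4 / v ^ 3) := by
          rw [mul_div_assoc]; gcongr
      _ = (m * g) ^ 2 := by rw [mul_pow, hgv]
      _ ≤ |chordIntegral v| ^ 2 := by gcongr
      _ = _ := sq_abs _
  -- With a = sin u - cos u and b = sin u + cos u, sin 2u - cos 2u = 1 - a² + ab. If |a| < 0.4 this
  -- is at least 1 - 0.16 - 0.568 > 0.26 = 0.18 + 0.08; otherwise |a| ≥ 0.36 + 0.04.
  by_cases ha : 0.4 ≤ |Real.sin u - Real.cos u|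
  · have := hlow u 0.04 0.36 (1 / 10000) hu0 (by norm_num) (by
      rw [div_le_iff₀ (by positivity)]; nlinarith) (by linarith) (by norm_num)
    nlinarith [sq_nonneg (chordIntegral (2 * u))]
  · have h := hlow (2 * u) 0.08 0.18 (8 / 10000) (by linarith) (by norm_num) (by
      rw [div_le_iff₀ (by positivity)]; nlinarith) (by
        push Not at ha
        have hsc := Real.sin_sq_add_cos_sq u
        have e : Real.sin (2 * u) - Real.cos (2 * u) = 1 - (Real.sin u - Real.cos u) ^ 2
            - -((Real.sin u - Real.cos u) * (Real.sin u + Real.cos u)) := by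
          rw [Real.sin_two_mul, Real.cos_two_mul']
          linear_combination hsc
        have hb : |Real.sin u + Real.cos u| ≤ 1.42 := by
          refine abs_le_of_sq_le_sq (by nlinarith [sq_nonneg (Real.sin u - Real.cos u)])
            (by norm_num)
        have hab : |(Real.sin u - Real.cos u) * (Real.sin u + Real.cos u)| ≤ 0.4 * 1.42 := by
          rw [abs_mul]; gcongr
        have ha2 : (Real.sin u - Real.cos u) ^ 2 ≤ 0.4 ^ 2 := by
          rw [← sq_abs]; gcongr
        refine le_trans ?_ (le_abs_self _)
        rw [e]
        have := (abs_le.1 hab).1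
        norm_num at *
        linarith) (by norm_num)
    have e : 8 / 10000 / (2 * u) ^ 3 = 1 / 10000 / u ^ 3 := by
      rw [mul_pow]; field_simp; norm_num
    rw [e] at h
    nlinarith [sq_nonneg (chordIntegral u)]

/-! ### Fourier coefficients of disks, in the plane and on the torus -/

theorem Torus2.volume_eq :
    (volume : Measure Torus2) = Measure.pi fun _ ↦ (AddCircle.haarAddCircle : Measure (AddCircle (1 : ℝ))) := by
  rw [volume_pi]
  simp [AddCircle.volume_eq_smul_haarAddCircle]

/-- The Fourier transform of a chord-length function. -/
theorem integral_sqrt_mul_cos {r : ℝ} (hr : 0 < r) (a : ℝ) :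
    ∫ x : ℝ, 2 * √(r ^ 2 - x ^ 2) * Real.cos (a * x) = 4 * r ^ 2 * chordIntegral (a * r) := by
  set F : ℝ → ℝ := fun x ↦ 2 * √(r ^ 2 - x ^ 2) * Real.cos (a * x) with hF
  have hFc : Continuous F := by fun_prop
  have h1 : ∫ x, F x = ∫ x in (-r)..r, F x := by
    rw [intervalIntegral.integral_of_le (by linarith)]
    refine (setIntegral_eq_integral_of_forall_compl_eq_zero fun x hx ↦ ?_).symm
    have : r ^ 2 - x ^ 2 ≤ 0 := by
      rw [Set.mem_Ioc, not_and_or, not_lt, not_le] at hx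
      rcases hx with hx | hx <;> nlinarith
    simp [hF, Real.sqrt_eq_zero_of_nonpos this]
  have h2 : ∫ x in (-r)..0, F x = ∫ x in (0 : ℝ)..r, F x := by
    have := intervalIntegral.integral_comp_neg (a := 0) (b := r) F
    rw [neg_zero] at this
    rw [← this]
    simp [hF]
  have h3 : ∫ x in (0 : ℝ)..r, F x = r * ∫ t in (0 : ℝ)..1, F (r * t) := by
    have := intervalIntegral.mul_integral_comp_mul_left (a := 0) (b := 1) (f := F) r
    rw [mul_zero, mul_one] at this
    exact this.symm
  have h4 : ∫ t in (0 : ℝ)..1, F (r * t) = 2 * r * chordIntegral (a * r) := by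
    rw [chordIntegral, ← intervalIntegral.integral_const_mul]
    refine intervalIntegral.integral_congr fun t _ ↦ ?_
    have : √(r ^ 2 - (r * t) ^ 2) = r * √(1 - t ^ 2) := by
      rw [show r ^ 2 - (r * t) ^ 2 = r ^ 2 * (1 - t ^ 2) by ring, Real.sqrt_mul (by positivity),
        Real.sqrt_sq hr.le]
    simp only [hF, this]
    ring_nf
  rw [h1, ← intervalIntegral.integral_add_adjacent_intervals (hFc.intervalIntegrable (-r) 0)
    (hFc.intervalIntegrable 0 r), h2, h3, h4]
  ring

/-- Fubini: the vertical slice of the disk at abscissa x has length 2√(r² - x²). -/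
theorem setIntegral_ball_cos_re {r : ℝ} (hr : 0 < r) (a : ℝ) :
    ∫ z in Metric.ball (0 : ℂ) r, Real.cos (a * z.re) = 4 * r ^ 2 * chordIntegral (a * r) := by
  rw [← integral_sqrt_mul_cos hr, ← integral_indicator Metric.isOpen_ball.measurableSet]
  set S : Set (ℝ × ℝ) := {p | p.1 ^ 2 + p.2 ^ 2 < r ^ 2} with hS
  have hSm : MeasurableSet S := measurableSet_lt (by fun_prop) (by fun_prop)
  have h1 : ∫ z : ℂ, (Metric.ball (0 : ℂ) r).indicator (fun z ↦ Real.cos (a * z.re)) z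
      = ∫ p : ℝ × ℝ, S.indicator (fun p ↦ Real.cos (a * p.1)) p := by
    rw [← Complex.volume_preserving_equiv_real_prod.integral_comp
      Complex.measurableEquivRealProd.measurableEmbedding]
    congr 1 with z
    have hm : z ∈ Metric.ball (0 : ℂ) r ↔ Complex.measurableEquivRealProd z ∈ S := by
      rw [mem_ball_zero_iff, ← sq_lt_sq₀ (norm_nonneg _) hr.le, Complex.sq_norm,
        Complex.normSq_apply]
      simp [hS, pow_two]
    by_cases h : z ∈ Metric.ball (0 : ℂ) r
    · rw [Set.indicator_of_mem h, Set.indicator_of_mem (hm.1 h)]; simp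
    · rw [Set.indicator_of_notMem h, Set.indicator_of_notMem (fun h' ↦ h (hm.2 h'))]
  have hint : Integrable (S.indicator fun p : ℝ × ℝ ↦ Real.cos (a * p.1)) (volume.prod volume) := by
    rw [integrable_indicator_iff hSm]
    have hsub : S ⊆ Metric.ball 0 r := by
      intro p hp
      have hp : p.1 ^ 2 + p.2 ^ 2 < r ^ 2 := hp
      rw [mem_ball_zero_iff, Prod.norm_def, max_lt_iff, Real.norm_eq_abs, Real.norm_eq_abs]
      constructor <;> refine abs_lt_of_sq_lt_sq ?_ hr.le <;> nlinarith [sq_nonneg p.1, sq_nonneg p.2]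
    refine IntegrableOn.mono_set (t := Metric.ball 0 r) ?_ hsub
    refine (Continuous.continuousOn (by fun_prop)).integrableOn_compact
      (isCompact_closedBall 0 r) |>.mono_set Metric.ball_subset_closedBall
  rw [h1, Measure.volume_eq_prod, integral_prod _ hint]
  congr 1 with x
  have : (fun y : ℝ ↦ S.indicator (fun p ↦ Real.cos (a * p.1)) (x, y))
      = (Set.Ioo (-√(r ^ 2 - x ^ 2)) √(r ^ 2 - x ^ 2)).indicator fun _ ↦ Real.cos (a * x) := by
    funext y
    have hm : (x, y) ∈ S ↔ y ∈ Set.Ioo (-√(r ^ 2 - x ^ 2)) √(r ^ 2 - x ^ 2) := by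
      rw [Set.mem_Ioo, ← abs_lt, Real.lt_sqrt (abs_nonneg _), sq_abs]
      simp only [hS, Set.mem_ofPred_eq]
      constructor <;> intro h <;> linarith
    by_cases h : (x, y) ∈ S
    · rw [Set.indicator_of_mem h, Set.indicator_of_mem (hm.1 h)]
    · rw [Set.indicator_of_notMem h, Set.indicator_of_notMem (fun h' ↦ h (hm.2 h'))]
  rw [this, integral_indicator measurableSet_Ioo, setIntegral_const, measureReal_def,
    Real.volume_Ioo, ENNReal.toReal_ofReal (by linarith [Real.sqrt_nonneg (r ^ 2 - x ^ 2)]), smul_eq_mul]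
  ring

/-- The Fourier transform of a planar disk. -/
theorem setIntegral_ball_cos {r : ℝ} (hr : 0 < r) {κ : ℂ} (hκ : κ ≠ 0) :
    ∫ z in Metric.ball (0 : ℂ) r, Real.cos (2 * Real.pi * (κ.re * z.re + κ.im * z.im))
      = 4 * r ^ 2 * chordIntegral (2 * Real.pi * ‖κ‖ * r) := by
  rw [← setIntegral_ball_cos_re hr]
  have hn : ‖κ‖ ≠ 0 := norm_ne_zero_iff.2 hκ
  -- The rotation that takes the direction of κ to the real axis, or back, preserves disk and area.
  let ω : Circle := ⟨κ / ‖κ‖, by simp [Submonoid.unitSphere, hn]⟩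
  have hω : (ω : ℂ) = κ / ‖κ‖ := rfl
  have hmp := (rotation ω).measurePreserving
  rw [← hmp.setIntegral_preimage_emb (rotation ω).toHomeomorph.measurableEmbedding]
  have hpre : (rotation ω) ⁻¹' Metric.ball (0 : ℂ) r = Metric.ball 0 r := by
    ext z
    rw [Set.mem_preimage, mem_ball_zero_iff, mem_ball_zero_iff, LinearIsometryEquiv.norm_map]
  rw [hpre]
  congr 1 with z
  have hk : Complex.normSq κ = ‖κ‖ * ‖κ‖ := Complex.normSq_eq_norm_sq κ ▸ pow_two _
  rw [Complex.normSq_apply] at hk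
  have e : ∀ w : ℂ, (κ / ‖κ‖ * w).re = (κ.re * w.re - κ.im * w.im) / ‖κ‖ ∧
      (κ / ‖κ‖ * w).im = (κ.re * w.im + κ.im * w.re) / ‖κ‖ := by
    intro w
    simp only [Complex.mul_re, Complex.mul_im, Complex.div_ofReal_re, Complex.div_ofReal_im]
    constructor <;> ring
  rw [rotation_apply, hω, (e z).1, (e z).2]
  congr 1
  field_simp
  linear_combination z.re * hk

theorem Torus2.integral_eq_setIntegral_pi {E : Type*} [NormedAddCommGroup E] [NormedSpace ℝ E]
    (f : Torus2 → E) (a : Fin 2 → ℝ) :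
    ∫ x, f x = ∫ x in {x : Fin 2 → ℝ | ∀ i, x i ∈ Set.Ioc (a i) (a i + 1)},
      f (fun i ↦ (x i : UnitAddCircle)) := by
  rw [Torus2.volume_eq]
  exact UnitAddTorus.integral_preimage f a

theorem torusDist_coe_zero {x : Fin 2 → ℝ} (hx : ∀ i, |x i| ≤ 1 / 2) :
    torusDist (fun i ↦ (x i : UnitAddCircle)) 0 = √(x 0 ^ 2 + x 1 ^ 2) := by
  have h : ∀ i, ‖(x i : UnitAddCircle)‖ = |x i| := fun i ↦
    (AddCircle.norm_coe_eq_abs_iff (p := 1) one_ne_zero).2 (by simpa using hx i)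
  simp [torusDist, h]

theorem continuous_torusDist_left (c : Torus2) : Continuous fun y : Torus2 ↦ torusDist y c := by
  unfold torusDist; fun_prop

theorem isOpen_openDisk (c : Torus2) (r : ℝ) : IsOpen (openDisk c r) := by
  unfold openDisk
  exact isOpen_lt (continuous_torusDist_left c) continuous_const

theorem re_mFourier_coe (k : Fin 2 → ℤ) (x : Fin 2 → ℝ) :
    (UnitAddTorus.mFourier k (fun i ↦ (x i : UnitAddCircle))).re
      = Real.cos (2 * Real.pi * (k 0 * x 0 + k 1 * x 1)) := by
  have : UnitAddTorus.mFourier k (fun i ↦ (x i : UnitAddCircle))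
      = Complex.exp ((2 * Real.pi * (k 0 * x 0 + k 1 * x 1) : ℝ) * Complex.I) := by
    simp only [UnitAddTorus.mFourier, ContinuousMap.coe_mk, Fin.prod_univ_two, fourier_coe_apply]
    rw [← Complex.exp_add]
    congr 1
    push_cast; ring
  rw [this, Complex.exp_ofReal_mul_I_re]

/-- The real part of a Fourier coefficient of a disk in the torus. -/
theorem re_integral_openDisk_mFourier {k : Fin 2 → ℤ} (hk : k ≠ 0) {r : ℝ} (hr : 0 < r)
    (hr2 : r ≤ 1 / 2) :
    (∫ y in openDisk 0 r, UnitAddTorus.mFourier k y).re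
      = 4 * r ^ 2 * chordIntegral (2 * Real.pi * √((k 0 : ℝ) ^ 2 + (k 1 : ℝ) ^ 2) * r) := by
  have hopen := isOpen_openDisk 0 r
  set κ : ℂ := ⟨k 0, k 1⟩ with hκ
  have hκ0 : κ ≠ 0 := by
    intro h
    apply hk
    have h0 := congrArg Complex.re h
    have h1 := congrArg Complex.im h
    simp only [hκ, Complex.zero_re, Complex.zero_im, Int.cast_eq_zero] at h0 h1
    funext i; fin_cases i <;> simpa
  have hκn : ‖κ‖ = √((k 0 : ℝ) ^ 2 + (k 1 : ℝ) ^ 2) := by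
    rw [Complex.norm_def, Complex.normSq_apply]; simp [hκ, pow_two]
  rw [← hκn, ← setIntegral_ball_cos hr hκ0, ← integral_indicator hopen.measurableSet,
    Torus2.integral_eq_setIntegral_pi _ (fun _ ↦ -(1 / 2))]
  set Q := {x : Fin 2 → ℝ | ∀ i, x i ∈ Set.Ioc (-(1 / 2 : ℝ)) (-(1 / 2) + 1)} with hQ
  have hQm : MeasurableSet Q := by
    have : Q = Set.univ.pi fun _ ↦ Set.Ioc (-(1 / 2 : ℝ)) (-(1 / 2) + 1) := by ext; simp [hQ]
    rw [this]; exact MeasurableSet.univ_pi fun _ ↦ measurableSet_Ioc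
  set P : ℂ → Torus2 := fun z i ↦ (Complex.measurableEquivPi z i : UnitAddCircle) with hP
  have hPc : Continuous P := by
    refine continuous_pi fun i ↦ (AddCircle.continuous_mk' 1).comp ?_
    fin_cases i
    · exact Complex.continuous_re
    · exact Complex.continuous_im
  -- Since r ≤ 1/2, the Euclidean ball fits in one fundamental square, where the torus distance to 0
  -- is the Euclidean norm.
  have hmem : ∀ z : ℂ, z ∈ Metric.ball (0 : ℂ) r ↔
      Complex.measurableEquivPi z ∈ Q ∧ P z ∈ openDisk 0 r := by
    intro z
    have hz0 : Complex.measurableEquivPi z 0 = z.re := rfl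
    have hz1 : Complex.measurableEquivPi z 1 = z.im := rfl
    have hnorm : ‖z‖ = √(z.re ^ 2 + z.im ^ 2) := by
      rw [Complex.norm_def, Complex.normSq_apply]; simp [pow_two]
    have hmk : (∀ i, |Complex.measurableEquivPi z i| ≤ 1 / 2) →
        (P z ∈ openDisk 0 r ↔ ‖z‖ < r) := by
      intro h
      rw [hnorm, ← hz0, ← hz1, ← torusDist_coe_zero h]
      rfl
    rw [mem_ball_zero_iff]
    constructor
    · intro h
      have h0 := (Complex.abs_re_le_norm z).trans_lt (h.trans_le hr2)
      have h1 := (Complex.abs_im_le_norm z).trans_lt (h.trans_le hr2)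
      refine ⟨Fin.forall_fin_two.2 ⟨?_, ?_⟩, (hmk (Fin.forall_fin_two.2 ⟨h0.le, h1.le⟩)).2 h⟩
      · rw [hz0]; constructor <;> linarith [abs_lt.1 h0]
      · rw [hz1]; constructor <;> linarith [abs_lt.1 h1]
    · rintro ⟨h, h'⟩
      refine (hmk fun i ↦ abs_le.2 ?_).1 h'
      constructor <;> linarith [(h i).1, (h i).2]
  have hint : IntegrableOn (fun z ↦ UnitAddTorus.mFourier k (P z)) (Metric.ball (0 : ℂ) r) :=
    (Continuous.continuousOn (by fun_prop)).integrableOn_compact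
      (isCompact_closedBall 0 r) |>.mono_set Metric.ball_subset_closedBall
  have hC : ∫ x in Q, (openDisk 0 r).indicator (fun y ↦ UnitAddTorus.mFourier k y)
      (fun i ↦ (x i : UnitAddCircle)) = ∫ z in Metric.ball (0 : ℂ) r, UnitAddTorus.mFourier k (P z) := by
    rw [← integral_indicator hQm, ← integral_indicator Metric.isOpen_ball.measurableSet,
      ← Complex.volume_preserving_equiv_pi.integral_comp
      Complex.measurableEquivPi.measurableEmbedding]
    congr 1 with z
    by_cases hz : z ∈ Metric.ball (0 : ℂ) r
    · rw [Set.indicator_of_mem hz, Set.indicator_of_mem ((hmem z).1 hz).1]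
      exact Set.indicator_of_mem ((hmem z).1 hz).2 _
    · rw [Set.indicator_of_notMem hz]
      by_cases hq : Complex.measurableEquivPi z ∈ Q
      · rw [Set.indicator_of_mem hq]
        exact Set.indicator_of_notMem (fun h ↦ hz ((hmem z).2 ⟨hq, h⟩)) _
      · rw [Set.indicator_of_notMem hq]
  rw [hC]
  refine (integral_re hint).symm.trans ?_
  congr 1 with z
  exact re_mFourier_coe k _

/-! ### Poisson kernels and the energy -/

/-- The periodic Poisson kernel. -/
noncomputable def poissonKer (ρ : ℝ) (θ : UnitAddCircle) : ℝ :=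
  (1 - ρ ^ 2) / Complex.normSq (1 - ρ * fourier 1 θ)

/-- Two geometric series, with ratio ρz for n ≥ 0 and its conjugate for n < 0, where |z| = 1. -/
theorem hasSum_poissonKer {ρ : ℝ} (h0 : 0 ≤ ρ) (h1 : ρ < 1) (θ : UnitAddCircle) :
    HasSum (fun n : ℤ ↦ (ρ : ℂ) ^ n.natAbs * fourier n θ) (poissonKer ρ θ : ℂ) := by
  set z : ℂ := fourier 1 θ with hz
  have hzn : ‖z‖ = 1 := by rw [hz, fourier_apply]; exact Circle.norm_coe _
  have hρ : ‖(ρ : ℂ)‖ = ρ := by rw [Complex.norm_real, Real.norm_of_nonneg h0]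
  have hpos : ∀ n : ℕ, fourier (n : ℤ) θ = z ^ n := by
    intro n
    induction n with
    | zero => simp
    | succ n ih => push_cast; rw [fourier_add, ih, pow_succ]
  have hlt : ‖(ρ : ℂ) * z‖ < 1 := by rw [norm_mul, hρ, hzn, mul_one]; exact h1
  have hlt' : ‖(ρ : ℂ) * (starRingEnd ℂ) z‖ < 1 := by
    rw [norm_mul, hρ, RCLike.norm_conj, hzn, mul_one]; exact h1
  have hne : 1 - (ρ : ℂ) * z ≠ 0 := fun h ↦ by
    rw [← sub_eq_zero.1 h] at hlt; simp at hlt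
  have hne' : 1 - (ρ : ℂ) * (starRingEnd ℂ) z ≠ 0 := fun h ↦ by
    rw [← sub_eq_zero.1 h] at hlt'; simp at hlt'
  have s1 := hasSum_geometric_of_norm_lt_one hlt
  have s2 := (hasSum_geometric_of_norm_lt_one hlt').mul_left ((ρ : ℂ) * (starRingEnd ℂ) z)
  have hsum : HasSum (fun n : ℤ ↦ (ρ : ℂ) ^ n.natAbs * fourier n θ)
      ((1 - (ρ : ℂ) * z)⁻¹ +
        (ρ : ℂ) * (starRingEnd ℂ) z * (1 - (ρ : ℂ) * (starRingEnd ℂ) z)⁻¹) := by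
    refine HasSum.of_nat_of_neg_add_one ?_ ?_
    · refine s1.congr_fun fun n ↦ ?_
      rw [hpos, Int.natAbs_natCast, mul_pow]
    · refine s2.congr_fun fun n ↦ ?_
      have : (-((n : ℤ) + 1)).natAbs = n + 1 := by omega
      rw [this, fourier_neg, ← Nat.cast_succ, hpos, map_pow, Nat.succ_eq_add_one, ← mul_pow,
        pow_succ']
  have hval : (poissonKer ρ θ : ℂ) = (1 - (ρ : ℂ) * z)⁻¹ +
        (ρ : ℂ) * (starRingEnd ℂ) z * (1 - (ρ : ℂ) * (starRingEnd ℂ) z)⁻¹ := by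
    have hzz : z * (starRingEnd ℂ) z = 1 := by
      rw [Complex.mul_conj, Complex.normSq_eq_norm_sq, hzn]; simp
    have hns : ((Complex.normSq (1 - ρ * z) : ℝ) : ℂ)
        = (1 - (ρ : ℂ) * z) * (1 - (ρ : ℂ) * (starRingEnd ℂ) z) := by
      rw [← Complex.mul_conj]; simp
    rw [poissonKer, ← hz, Complex.ofReal_div, hns]
    field_simp
    push_cast
    linear_combination (ρ : ℂ) ^ 2 * hzz
  rw [hval]; exact hsum

/-- For φ = 2πt the left side is (1 - ρ)² + 2ρ(1 - cos φ), and 1 - cos φ ≤ φ²/2. -/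
theorem normSq_one_sub_fourier_le {ρ : ℝ} (h0 : 0 ≤ ρ) (h1 : ρ ≤ 1) (θ : UnitAddCircle) :
    Complex.normSq (1 - ρ * fourier 1 θ) ≤ (1 - ρ) ^ 2 + 4 * Real.pi ^ 2 * ‖θ‖ ^ 2 := by
  obtain ⟨t, rfl, ht⟩ : ∃ t : ℝ, (t : UnitAddCircle) = θ ∧ ‖θ‖ = |t| := by
    induction θ using QuotientAddGroup.induction_on with
    | H t =>
      refine ⟨t - round t, ?_, UnitAddCircle.norm_eq⟩
      simp
  have e : (fourier 1 (t : UnitAddCircle) : ℂ) = Complex.exp ((2 * Real.pi * t : ℝ) * Complex.I) := by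
    rw [fourier_coe_apply]; congr 1; push_cast; ring
  rw [ht, sq_abs, e, Complex.exp_mul_I, ← Complex.ofReal_cos, ← Complex.ofReal_sin,
    Complex.normSq_apply]
  simp only [Complex.sub_re, Complex.one_re, Complex.mul_re, Complex.ofReal_re, Complex.add_re,
    Complex.I_re, mul_zero, Complex.ofReal_im, Complex.I_im, mul_one, sub_self, add_zero, zero_mul,
    sub_zero, Complex.sub_im, Complex.one_im, Complex.mul_im, Complex.add_im, zero_add]
  have hc := Real.one_sub_sq_div_two_le_cos (x := 2 * Real.pi * t)
  have hs := Real.sin_sq_add_cos_sq (2 * Real.pi * t)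
  nlinarith [mul_le_mul_of_nonneg_left hc h0, mul_nonneg (sub_nonneg.2 h1)
    (sq_nonneg (2 * Real.pi * t))]

theorem poissonKer_ge {ρ : ℝ} (h0 : 0 ≤ ρ) (h1 : ρ < 1) (θ : UnitAddCircle) :
    (1 - ρ) / ((1 - ρ) ^ 2 + 4 * Real.pi ^ 2 * ‖θ‖ ^ 2) ≤ poissonKer ρ θ := by
  have hle := normSq_one_sub_fourier_le h0 h1.le θ
  have hne : 1 - (ρ : ℂ) * fourier 1 θ ≠ 0 := fun h ↦ by
    have : ‖(ρ : ℂ) * fourier 1 θ‖ = ρ := by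
      rw [norm_mul, Complex.norm_real, Real.norm_of_nonneg h0, fourier_apply, Circle.norm_coe,
        mul_one]
    rw [← sub_eq_zero.1 h] at this; simp at this; linarith
  have hp := Complex.normSq_pos.2 hne
  rw [poissonKer]
  have : 1 - ρ ≤ 1 - ρ ^ 2 := by nlinarith
  have : 0 ≤ 1 - ρ ^ 2 := by nlinarith
  gcongr

theorem poissonKer_nonneg {ρ : ℝ} (h0 : 0 ≤ ρ) (h1 : ρ < 1) (θ : UnitAddCircle) :
    0 ≤ poissonKer ρ θ :=
  le_trans (div_nonneg (by linarith) (by positivity)) (poissonKer_ge h0 h1 θ)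

theorem mFourier_two (k : Fin 2 → ℤ) (y : Torus2) :
    UnitAddTorus.mFourier k y = fourier (k 0) (y 0) * fourier (k 1) (y 1) := by
  simp [UnitAddTorus.mFourier]

theorem hasSum_poissonKer_mul {ρ : ℝ} (h0 : 0 ≤ ρ) (h1 : ρ < 1) (y : Torus2) :
    HasSum (fun k : Fin 2 → ℤ ↦ (ρ : ℂ) ^ ((k 0).natAbs + (k 1).natAbs) * UnitAddTorus.mFourier k y)
      ((poissonKer ρ (y 0) * poissonKer ρ (y 1) : ℝ) : ℂ) := by
  have a := hasSum_poissonKer h0 h1 (y 0)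
  have b := hasSum_poissonKer h0 h1 (y 1)
  have hs := summable_mul_of_summable_norm a.summable.norm b.summable.norm
  have h := a.mul b hs
  rw [← (finTwoArrowEquiv ℤ).hasSum_iff] at h
  rw [Complex.ofReal_mul]
  refine h.congr_fun fun k ↦ ?_
  change _ = (ρ : ℂ) ^ (k 0).natAbs * fourier (k 0) (y 0) *
    ((ρ : ℂ) ^ (k 1).natAbs * fourier (k 1) (y 1))
  rw [mFourier_two]
  ring

/-- The exponential sum of a point set. -/
noncomputable def expSum {N : ℕ} (x : Fin N → Torus2) (k : Fin 2 → ℤ) : ℂ :=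
  ∑ i, UnitAddTorus.mFourier k (x i)

theorem mFourier_sub (k : Fin 2 → ℤ) (x y : Torus2) :
    UnitAddTorus.mFourier k (x - y)
      = UnitAddTorus.mFourier k x * (starRingEnd ℂ) (UnitAddTorus.mFourier k y) := by
  have h : ∀ (n : ℤ) (a b : UnitAddCircle),
      (fourier n (a - b) : ℂ) = fourier n a * (starRingEnd ℂ) (fourier n b) := by
    intro n a b
    rw [← fourier_neg]
    simp [fourier_apply, sub_eq_add_neg, AddCircle.toCircle_add]
  simp only [mFourier_two, map_mul]
  rw [← mul_mul_mul_comm, ← h, ← h]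
  rfl

theorem norm_expSum_sq {N : ℕ} (x : Fin N → Torus2) (k : Fin 2 → ℤ) :
    ((‖expSum x k‖ ^ 2 : ℝ) : ℂ) = ∑ i, ∑ j, UnitAddTorus.mFourier k (x i - x j) := by
  push_cast
  rw [← Complex.mul_conj', expSum, map_sum, Finset.sum_mul_sum]
  simp only [mFourier_sub]

/-- Expanding |S(k)|² over pairs turns the Poisson energy into a sum of nonnegative terms over
frequencies. -/
theorem hasSum_norm_expSum_sq {N : ℕ} (x : Fin N → Torus2) {ρ : ℝ} (h0 : 0 ≤ ρ) (h1 : ρ < 1) :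
    HasSum (fun k : Fin 2 → ℤ ↦ ρ ^ ((k 0).natAbs + (k 1).natAbs) * ‖expSum x k‖ ^ 2)
      (∑ i, ∑ j, poissonKer ρ ((x i - x j) 0) * poissonKer ρ ((x i - x j) 1)) := by
  rw [← Complex.hasSum_ofReal]
  push_cast
  have := hasSum_sum (s := Finset.univ) fun i _ ↦ hasSum_sum (s := Finset.univ)
    fun j _ ↦ hasSum_poissonKer_mul h0 h1 (x i - x j)
  push_cast at this
  refine this.congr_fun fun k ↦ ?_
  have e := norm_expSum_sq x k
  push_cast at e
  rw [e, Finset.mul_sum]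
  simp only [Finset.mul_sum]

/-- The product of Poisson kernels at scale `N^{-1/2}` majorizes the kernel of `rieszEnergy`. -/
theorem poissonKer_mul_ge {N : ℝ} (hN : 1 ≤ N) (y : Torus2) :
    N / (1 + N ^ 2 * torusDist y 0 ^ 4) ≤ 128 * Real.pi ^ 4 *
      (poissonKer (1 - 1 / (2 * √N)) (y 0) * poissonKer (1 - 1 / (2 * √N)) (y 1)) := by
  have hs : 1 ≤ √N := Real.one_le_sqrt.2 hN
  have hs2 : √N ^ 2 = N := Real.sq_sqrt (by linarith)
  have hd : 1 / (2 * √N) ≤ 1 / 2 := by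
    rw [div_le_div_iff₀ (by positivity) (by norm_num)]; linarith
  have hpi := Real.pi_gt_three
  have key : ∀ θ : UnitAddCircle, 2 * √N / (1 + 16 * Real.pi ^ 2 * N * ‖θ‖ ^ 2)
      ≤ poissonKer (1 - 1 / (2 * √N)) θ := by
    intro θ
    refine le_trans (le_of_eq ?_) (poissonKer_ge (by linarith) (by simp; positivity) θ)
    rw [sub_sub_cancel]
    generalize √N = σ at hs hs2
    subst hs2
    field_simp
    ring
  set a := ‖y 0‖
  set b := ‖y 1‖
  have hd4 : torusDist y 0 ^ 4 = (a ^ 2 + b ^ 2) ^ 2 := by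
    have : torusDist y 0 ^ 2 = a ^ 2 + b ^ 2 := by
      rw [torusDist, Real.sq_sqrt (by positivity)]; simp [a, b]
    rw [← this]; ring
  have h2 : 4 * N / ((1 + 16 * Real.pi ^ 2 * N * a ^ 2) * (1 + 16 * Real.pi ^ 2 * N * b ^ 2))
      ≤ poissonKer (1 - 1 / (2 * √N)) (y 0) * poissonKer (1 - 1 / (2 * √N)) (y 1) := by
    refine le_trans (le_of_eq ?_) (mul_le_mul (key (y 0)) (key (y 1)) (by positivity)
      (poissonKer_nonneg (by linarith) (by simp; positivity) _))
    rw [div_mul_div_comm]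
    congr 1
    linear_combination -4 * hs2
  refine le_trans ?_ (mul_le_mul_of_nonneg_left h2 (by positivity))
  rw [hd4, ← mul_div_assoc, div_le_div_iff₀ (by positivity) (by positivity)]
  -- The constant 512 = 2·16² comes from (1 + t)² ≤ 2 + 2t² with t = 16π²N(a² + b²).
  have hM : (1 + 16 * Real.pi ^ 2 * N * a ^ 2) * (1 + 16 * Real.pi ^ 2 * N * b ^ 2)
      ≤ 512 * Real.pi ^ 4 * (1 + N ^ 2 * (a ^ 2 + b ^ 2) ^ 2) := by
    set p := Real.pi ^ 2 with hp
    have hp9 : 9 ≤ p := by nlinarith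
    have hp4 : Real.pi ^ 4 = p ^ 2 := by rw [hp]; ring
    set A := N * a ^ 2 with hA
    set B := N * b ^ 2 with hB
    have hA0 : 0 ≤ A := by positivity
    have hB0 : 0 ≤ B := by positivity
    have e : N ^ 2 * (a ^ 2 + b ^ 2) ^ 2 = (A + B) ^ 2 := by rw [hA, hB]; ring
    rw [hp4, e]
    have e1 : (1 + 16 * p * N * a ^ 2) * (1 + 16 * p * N * b ^ 2)
      = (1 + 16 * p * A) * (1 + 16 * p * B) := by rw [hA, hB]; ring
    rw [e1]
    have h3 : (1 + 16 * p * A) * (1 + 16 * p * B) ≤ (1 + 16 * p * (A + B)) ^ 2 := by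
      rw [pow_two]
      have : 0 ≤ 16 * p := by linarith
      gcongr <;> linarith
    have h4 : (1 + 16 * p * (A + B)) ^ 2 ≤ 2 + 2 * (16 * p * (A + B)) ^ 2 := by
      nlinarith [sq_nonneg (1 - 16 * p * (A + B))]
    nlinarith
  calc N * ((1 + 16 * Real.pi ^ 2 * N * a ^ 2) * (1 + 16 * Real.pi ^ 2 * N * b ^ 2))
      ≤ N * (512 * Real.pi ^ 4 * (1 + N ^ 2 * (a ^ 2 + b ^ 2) ^ 2)) := by gcongr
    _ = _ := by ring

theorem torusDist_sub_zero (x y : Torus2) : torusDist (x - y) 0 = torusDist x y := by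
  simp [torusDist]

/-- The exponential decay of the Poisson multiplier against the cubic decay of disks. -/
theorem pow_mul_cube_le {N : ℝ} (hN : 1 ≤ N) (m : ℕ) :
    (1 - 1 / (2 * √N)) ^ m * (m : ℝ) ^ 3 ≤ 48 * (N * √N) := by
  have hs : 1 ≤ √N := Real.one_le_sqrt.2 hN
  have hs2 : √N ^ 2 = N := Real.sq_sqrt (by linarith)
  have hd : 1 / (2 * √N) ≤ 1 / 2 := by
    rw [div_le_div_iff₀ (by positivity) (by norm_num)]; linarith
  set δ := 1 / (2 * √N) with hδ
  have hδ0 : 0 < δ := by positivity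
  have h1 : (1 - δ) ^ m ≤ Real.exp (-(δ * m)) := by
    have : 1 - δ ≤ Real.exp (-δ) := by linarith [Real.add_one_le_exp (-δ)]
    calc (1 - δ) ^ m ≤ Real.exp (-δ) ^ m := by
          have : 0 ≤ 1 - δ := by linarith
          gcongr
      _ = _ := by rw [← Real.exp_nat_mul]; congr 1; ring
  -- From t³/3! ≤ e^t with t = δm; then 48 = 6·8, since δ⁻³ = 8N√N.
  have h2 := Real.pow_div_factorial_le_exp (δ * m) (by positivity) 3
  have h3 : Real.exp (-(δ * m)) * Real.exp (δ * m) = 1 := by rw [← Real.exp_add]; simp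
  have h4 : Real.exp (-(δ * m)) * (δ * m) ^ 3 ≤ 6 := by
    have h5 : (δ * m) ^ 3 ≤ 6 * Real.exp (δ * m) := by
      norm_num [Nat.factorial] at h2; linarith
    nlinarith [mul_le_mul_of_nonneg_left h5 (Real.exp_pos (-(δ * m))).le]
  have h6 : (m : ℝ) ^ 3 = (δ * m) ^ 3 * (8 * (N * √N)) := by
    rw [hδ]
    clear_value δ
    generalize √N = σ at hs hs2
    subst hs2
    field_simp
    norm_num
  calc (1 - δ) ^ m * (m : ℝ) ^ 3 ≤ Real.exp (-(δ * m)) * (m : ℝ) ^ 3 := by gcongr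
    _ = Real.exp (-(δ * m)) * (δ * m) ^ 3 * (8 * (N * √N)) := by rw [h6]; ring
    _ ≤ 6 * (8 * (N * √N)) := by gcongr
    _ = _ := by ring

/-! ### Parseval, characters and null circles -/

/-- Parseval's identity on the torus, for the normalized Lebesgue measure. -/
theorem hasSum_sq_integral_mFourier_mul {g : Torus2 → ℂ} (hg : MemLp g 2 volume) :
    HasSum (fun k : Fin 2 → ℤ ↦ ‖∫ y, UnitAddTorus.mFourier (-k) y * g y‖ ^ 2)
      (∫ y, ‖g y‖ ^ 2) := by
  rw [Torus2.volume_eq] at hg ⊢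
  have h := UnitAddTorus.hasSum_sq_mFourierCoeff (d := Fin 2) (hg.toLp g)
  have e1 : ∫ y, ‖hg.toLp g y‖ ^ 2 ∂(Measure.pi fun _ ↦ AddCircle.haarAddCircle)
      = ∫ y, ‖g y‖ ^ 2 ∂(Measure.pi fun _ ↦ AddCircle.haarAddCircle) := by
    refine integral_congr_ae ?_
    filter_upwards [hg.coeFn_toLp] with y hy
    rw [hy]
  rw [← e1]
  refine HasSum.congr_fun h fun k ↦ ?_
  congr 2
  refine integral_congr_ae ?_
  filter_upwards [hg.coeFn_toLp] with y hy
  rw [hy, smul_eq_mul]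

instance Torus2.isProbabilityMeasure : IsProbabilityMeasure (volume : Measure Torus2) := by
  rw [Torus2.volume_eq]; infer_instance

theorem mFourier_add_right (k : Fin 2 → ℤ) (x y : Torus2) :
    UnitAddTorus.mFourier k (x + y) = UnitAddTorus.mFourier k x * UnitAddTorus.mFourier k y := by
  have h : ∀ (n : ℤ) (a b : UnitAddCircle),
      (fourier n (a + b) : ℂ) = fourier n a * fourier n b := by
    intro n a b
    simp [fourier_apply, AddCircle.toCircle_add]
  simp only [mFourier_two]
  rw [← mul_mul_mul_comm, ← h, ← h]
  rfl

/-- Translation by half a period in a coordinate with k i ≠ 0 changes the sign of the character but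
not its integral. -/
theorem integral_mFourier_eq_zero {k : Fin 2 → ℤ} (hk : k ≠ 0) :
    ∫ y : Torus2, UnitAddTorus.mFourier k y = 0 := by
  obtain ⟨i, hi⟩ := Function.ne_iff.1 hk
  set b : Torus2 := Pi.single i ((1 / 2 / (k i) : ℝ) : UnitAddCircle) with hb
  have hval : ∀ y : Torus2, UnitAddTorus.mFourier k (y + b) = - UnitAddTorus.mFourier k y := by
    intro y
    have h := fourier_add_half_inv_index (T := 1) hi one_pos 0
    rw [zero_add, fourier_eval_zero] at h
    have hbv : UnitAddTorus.mFourier k b = -1 := by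
      rw [UnitAddTorus.mFourier, ContinuousMap.coe_mk, Finset.prod_eq_single i, hb,
        Pi.single_eq_same, h]
      · intro j _ hj
        rw [hb, Pi.single_eq_of_ne hj, fourier_eval_zero]
      · simp
    rw [mFourier_add_right, hbv, mul_neg_one]
  have h := integral_add_right_eq_self (μ := (volume : Measure Torus2))
    (fun y ↦ UnitAddTorus.mFourier k y) b
  simp only [hval, integral_neg] at h
  exact self_eq_neg.1 h.symm

theorem torusDist_comm (x y : Torus2) : torusDist x y = torusDist y x := by
  simp only [torusDist, norm_sub_rev]

theorem torusDist_add_right (x y z : Torus2) : torusDist (x + z) (y + z) = torusDist x y := by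
  simp [torusDist]

/-- Circles are null sets. -/
theorem volume_torusDist_eq (c : Torus2) {r : ℝ} (hr : 0 < r) :
    volume {y : Torus2 | torusDist y c = r} = 0 := by
  set S : Set Torus2 := {y | torusDist y 0 = r} with hS
  have hSm : MeasurableSet S :=
    measurableSet_eq_fun (continuous_torusDist_left 0).measurable measurable_const
  have h1 : {y : Torus2 | torusDist y c = r} = (fun y ↦ y + -c) ⁻¹' S := by
    ext y
    have := torusDist_add_right y c (-c)
    rw [add_neg_cancel] at this
    simp only [hS, Set.mem_preimage, Set.mem_ofPred_eq, this]
  rw [h1, measure_preimage_add_right]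
  have hplane : volume {x : Fin 2 → ℝ | √(x 0 ^ 2 + x 1 ^ 2) = r} = 0 := by
    rw [← Complex.volume_preserving_equiv_pi.measure_preimage_emb
      Complex.measurableEquivPi.measurableEmbedding]
    have : Complex.measurableEquivPi ⁻¹' {x : Fin 2 → ℝ | √(x 0 ^ 2 + x 1 ^ 2) = r}
        = Metric.sphere 0 r := by
      ext z
      rw [mem_sphere_zero_iff_norm, Complex.norm_def, Complex.normSq_apply, ← pow_two, ← pow_two]
      rfl
    rw [this]
    exact Measure.addHaar_sphere_of_ne_zero _ _ hr.ne'
  have h2 := Torus2.integral_eq_setIntegral_pi (S.indicator fun _ ↦ (1 : ℝ)) (fun _ ↦ -(1 / 2))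
  rw [integral_indicator hSm, setIntegral_const, smul_eq_mul, mul_one] at h2
  have h3 : ∫ x in {x : Fin 2 → ℝ | ∀ i, x i ∈ Set.Ioc (-(1 / 2 : ℝ)) (-(1 / 2) + 1)},
      (S.indicator fun _ ↦ (1 : ℝ)) (fun i ↦ (x i : UnitAddCircle)) = 0 := by
    refine setIntegral_eq_zero_of_ae_eq_zero ?_
    have : ∀ᵐ x : Fin 2 → ℝ, √(x 0 ^ 2 + x 1 ^ 2) ≠ r := by
      rw [ae_iff]; simpa using hplane
    filter_upwards [this] with x hx hxQ
    refine Set.indicator_of_notMem (fun hxS ↦ hx ?_) _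
    rw [← torusDist_coe_zero fun i ↦ abs_le.2 ⟨(hxQ i).1.le, by linarith [(hxQ i).2]⟩]
    exact hxS
  rw [h3] at h2
  exact (measureReal_eq_zero_iff).1 h2

/-! ### The discrepancy as a function of the center -/

/-- The signed discrepancy of the open disk of radius `r`, as a function of its center. -/
noncomputable def signedDiscrepancy {N : ℕ} (x : Fin N → Torus2) (r : ℝ) (c : Torus2) : ℝ :=
  ∑ i, (openDisk (x i) r).indicator (fun _ ↦ (1 : ℝ)) c
    - N * (volume : Measure Torus2).real (openDisk 0 r)

theorem volume_real_openDisk (c : Torus2) (r : ℝ) :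
    (volume : Measure Torus2).real (openDisk c r) = (volume : Measure Torus2).real (openDisk 0 r) := by
  have h1 : openDisk c r = (fun y ↦ y + -c) ⁻¹' openDisk 0 r := by
    ext y
    have := torusDist_add_right y c (-c)
    rw [add_neg_cancel] at this
    simp only [openDisk, Set.mem_preimage, Set.mem_ofPred_eq, this]
  rw [measureReal_def, h1, measure_preimage_add_right, ← measureReal_def]

/-- A point lies in the disk about c exactly when c lies in the disk about the point. -/
theorem discrepancy_openDisk {N : ℕ} (x : Fin N → Torus2) (r : ℝ) (c : Torus2) :
    discrepancy x (openDisk c r) = |signedDiscrepancy x r c| := by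
  classical
  rw [discrepancy, signedDiscrepancy, volume_real_openDisk]
  congr 2
  rw [Set.ncard_eq_toFinset_card', Set.toFinset_ofPred, ← Finset.sum_boole]
  refine Finset.sum_congr rfl fun i _ ↦ ?_
  rw [Set.indicator_apply]
  simp only [openDisk, Set.mem_ofPred_eq, torusDist_comm (x i) c]
  congr

theorem discrepancy_closedDisk {N : ℕ} (x : Fin N → Torus2) {r : ℝ} (hr : 0 < r) {c : Torus2}
    (hc : ∀ i, torusDist c (x i) ≠ r) :
    discrepancy x (closedDisk c r) = discrepancy x (openDisk c r) := by
  have h1 : {i | x i ∈ closedDisk c r} = {i | x i ∈ openDisk c r} := by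
    ext i
    have := hc i
    rw [torusDist_comm] at this
    simp only [closedDisk, openDisk, Set.mem_ofPred_eq]
    exact ⟨fun h ↦ lt_of_le_of_ne h this, le_of_lt⟩
  have h2 : (volume : Measure Torus2).real (closedDisk c r) = (volume : Measure Torus2).real (openDisk c r) := by
    refine measureReal_congr ?_
    have : ∀ᵐ y : Torus2, torusDist y c ≠ r := by
      rw [ae_iff]; simpa using volume_torusDist_eq c hr
    filter_upwards [this] with y hy
    refine propext ⟨fun h ↦ lt_of_le_of_ne h hy, fun h ↦ le_of_lt h⟩
  rw [discrepancy, discrepancy, h1, h2]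

theorem integral_mFourier_mul_indicator (k : Fin 2 → ℤ) (r : ℝ) (a : Torus2) :
    ∫ y, UnitAddTorus.mFourier k y * (((openDisk a r).indicator (fun _ ↦ (1 : ℝ)) y : ℝ) : ℂ)
      = UnitAddTorus.mFourier k a * ∫ y in openDisk 0 r, UnitAddTorus.mFourier k y := by
  rw [← integral_add_right_eq_self _ a, ← integral_indicator (isOpen_openDisk 0 r).measurableSet,
    ← integral_const_mul]
  congr 1 with y
  have hm : y + a ∈ openDisk a r ↔ y ∈ openDisk 0 r := by
    have := torusDist_add_right y 0 a
    rw [zero_add] at this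
    simp only [openDisk, Set.mem_ofPred_eq, this]
  by_cases h : y ∈ openDisk 0 r
  · rw [Set.indicator_of_mem h, Set.indicator_of_mem (hm.2 h), mFourier_add_right]
    simp [mul_comm]
  · rw [Set.indicator_of_notMem h, Set.indicator_of_notMem (fun h' ↦ h (hm.1 h'))]; simp

theorem measurable_signedDiscrepancy {N : ℕ} (x : Fin N → Torus2) (r : ℝ) :
    Measurable (signedDiscrepancy x r) := by
  refine Measurable.sub (Finset.measurable_fun_sum _ fun i _ ↦ ?_) measurable_const
  exact measurable_const.indicator (isOpen_openDisk _ _).measurableSet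

theorem abs_signedDiscrepancy_le {N : ℕ} (x : Fin N → Torus2) (r : ℝ) (c : Torus2) :
    |signedDiscrepancy x r c| ≤ N := by
  have h1 : ∑ i, (openDisk (x i) r).indicator (fun _ ↦ (1 : ℝ)) c ≤ N := by
    refine (Finset.sum_le_card_nsmul _ _ 1 fun i _ ↦ ?_).trans (by simp)
    exact Set.indicator_le_self' (fun _ _ ↦ zero_le_one) c
  have h2 : 0 ≤ ∑ i, (openDisk (x i) r).indicator (fun _ ↦ (1 : ℝ)) c :=
    Finset.sum_nonneg fun i _ ↦ Set.indicator_nonneg (fun _ _ ↦ zero_le_one) c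
  have h3 : (volume : Measure Torus2).real (openDisk 0 r) ≤ 1 := measureReal_le_one
  have h4 : 0 ≤ (volume : Measure Torus2).real (openDisk 0 r) := measureReal_nonneg
  have h5 : (N : ℝ) * (volume : Measure Torus2).real (openDisk 0 r) ≤ N * 1 := by gcongr
  have h6 : 0 ≤ (N : ℝ) * (volume : Measure Torus2).real (openDisk 0 r) := by positivity
  rw [signedDiscrepancy, abs_le]
  constructor <;> linarith

/-- The discrepancy is the convolution of the point masses with a disk, minus a constant that
frequencies k ≠ 0 do not see. -/
theorem integral_mFourier_mul_signedDiscrepancy {N : ℕ} (x : Fin N → Torus2) (r : ℝ)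
    {k : Fin 2 → ℤ} (hk : k ≠ 0) :
    ∫ y, UnitAddTorus.mFourier k y * (signedDiscrepancy x r y : ℂ)
      = expSum x k * ∫ y in openDisk 0 r, UnitAddTorus.mFourier k y := by
  have hc : Integrable (fun y : Torus2 ↦ UnitAddTorus.mFourier k y) :=
    (map_continuous _).integrable_of_hasCompactSupport (HasCompactSupport.of_compactSpace _)
  have hi : ∀ i, Integrable fun y ↦ UnitAddTorus.mFourier k y *
      (((openDisk (x i) r).indicator (fun _ ↦ (1 : ℝ)) y : ℝ) : ℂ) := by
    intro i
    refine hc.mul_bdd (c := 1) ?_ (Filter.Eventually.of_forall fun y ↦ ?_)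
    · exact (Complex.measurable_ofReal.comp (measurable_const.indicator
        (isOpen_openDisk _ _).measurableSet)).aestronglyMeasurable
    · rw [Complex.norm_real]
      exact (norm_indicator_le_norm_self _ _).trans (by simp)
  have e : ∀ y, UnitAddTorus.mFourier k y * (signedDiscrepancy x r y : ℂ)
      = ∑ i, UnitAddTorus.mFourier k y *
        (((openDisk (x i) r).indicator (fun _ ↦ (1 : ℝ)) y : ℝ) : ℂ)
        - UnitAddTorus.mFourier k y * (N * (volume : Measure Torus2).real (openDisk 0 r) : ℝ) := by
    intro y
    rw [signedDiscrepancy, Complex.ofReal_sub, Complex.ofReal_sum, mul_sub, Finset.mul_sum]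
  simp only [e]
  rw [integral_sub (integrable_finsetSum _ fun i _ ↦ hi i) (hc.mul_const _),
    integral_finsetSum _ fun i _ ↦ hi i, integral_mul_const, integral_mFourier_eq_zero hk, zero_mul,
    sub_zero, expSum, Finset.sum_mul]
  simp only [integral_mFourier_mul_indicator]

theorem norm_expSum_neg {N : ℕ} (x : Fin N → Torus2) (k : Fin 2 → ℤ) :
    ‖expSum x (-k)‖ = ‖expSum x k‖ := by
  have : expSum x (-k) = (starRingEnd ℂ) (expSum x k) := by
    simp only [expSum, map_sum, UnitAddTorus.mFourier_neg]
  rw [this, RCLike.norm_conj]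

/-- The mean square discrepancy as a Fourier series. -/
theorem hasSum_signedDiscrepancy {N : ℕ} (x : Fin N → Torus2) (r : ℝ) :
    HasSum (fun k : Fin 2 → ℤ ↦
        ‖∫ y, UnitAddTorus.mFourier (-k) y * (signedDiscrepancy x r y : ℂ)‖ ^ 2)
      (∫ y, signedDiscrepancy x r y ^ 2) := by
  have hmem : MemLp (fun y ↦ (signedDiscrepancy x r y : ℂ)) 2 volume := by
    refine MemLp.of_bound (Complex.measurable_ofReal.comp
      (measurable_signedDiscrepancy x r)).aestronglyMeasurable N
      (Filter.Eventually.of_forall fun y ↦ ?_)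
    rw [Complex.norm_real]
    exact abs_signedDiscrepancy_le x r y
  simpa only [Complex.norm_real, Real.norm_eq_abs, sq_abs] using
    hasSum_sq_integral_mFourier_mul hmem

theorem norm_integral_mFourier_mul_signedDiscrepancy_ge {N : ℕ} (x : Fin N → Torus2) {r : ℝ}
    (hr : 0 < r) (hr2 : r ≤ 1 / 2) {k : Fin 2 → ℤ} (hk : k ≠ 0) :
    (4 * r ^ 2 * chordIntegral (2 * Real.pi * √((k 0 : ℝ) ^ 2 + (k 1 : ℝ) ^ 2) * r)) ^ 2
        * ‖expSum x k‖ ^ 2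
      ≤ ‖∫ y, UnitAddTorus.mFourier (-k) y * (signedDiscrepancy x r y : ℂ)‖ ^ 2 := by
  rw [integral_mFourier_mul_signedDiscrepancy x r (neg_ne_zero.2 hk), norm_mul, norm_expSum_neg]
  have h := re_integral_openDisk_mFourier (neg_ne_zero.2 hk) hr hr2
  simp only [Pi.neg_apply, Int.cast_neg, neg_sq] at h
  rw [← h, ← sq_abs (Complex.re _), mul_pow, mul_comm]
  gcongr
  exact Complex.abs_re_le_norm _

/-- A Poisson mean of `‖expSum x k‖²` is controlled, off `k = 0`, by the discrepancies of disks
of radii `1/4` and `1/2`. -/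
theorem pow_mul_norm_expSum_sq_le {N : ℕ} (hN : 1 ≤ N) (x : Fin N → Torus2) (k : Fin 2 → ℤ) :
    (1 - 1 / (2 * √(N : ℝ))) ^ ((k 0).natAbs + (k 1).natAbs) * ‖expSum x k‖ ^ 2
      ≤ (if k = 0 then (N : ℝ) ^ 2 else 0) + 61440000 * (N * √N) *
        (‖∫ y, UnitAddTorus.mFourier (-k) y * (signedDiscrepancy x (1 / 4) y : ℂ)‖ ^ 2
        + ‖∫ y, UnitAddTorus.mFourier (-k) y * (signedDiscrepancy x (1 / 2) y : ℂ)‖ ^ 2) := by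
  have hN' : (1 : ℝ) ≤ N := by exact_mod_cast hN
  by_cases hk : k = 0
  · subst hk
    have h0 : expSum x 0 = N := by simp [expSum, UnitAddTorus.mFourier_zero]
    rw [h0, if_pos rfl]
    simp only [Pi.zero_apply, Int.natAbs_zero, add_zero, pow_zero, one_mul, Complex.norm_natCast]
    refine le_add_of_nonneg_right (by positivity)
  rw [if_neg hk, zero_add]
  set m := (k 0).natAbs + (k 1).natAbs with hm
  set κ := √((k 0 : ℝ) ^ 2 + (k 1 : ℝ) ^ 2) with hκ
  have hκ1 : 1 ≤ κ := by
    rw [hκ, Real.one_le_sqrt]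
    have : (1 : ℤ) ≤ (k 0) ^ 2 + (k 1) ^ 2 := by
      by_contra hlt
      apply hk
      have h0 : k 0 = 0 := by nlinarith [sq_nonneg (k 0), sq_nonneg (k 1)]
      have h1 : k 1 = 0 := by nlinarith [sq_nonneg (k 0), sq_nonneg (k 1)]
      funext i; fin_cases i <;> simpa
    exact_mod_cast this
  have hκm : κ ≤ m := by
    refine Real.sqrt_le_iff.2 ⟨by positivity, ?_⟩
    rw [hm, Nat.cast_add, Nat.cast_natAbs, Nat.cast_natAbs, Int.cast_abs, Int.cast_abs,
      ← sq_abs (k 0 : ℝ), ← sq_abs (k 1 : ℝ)]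
    nlinarith [abs_nonneg (k 0 : ℝ), abs_nonneg (k 1 : ℝ)]
  have hm0 : (0 : ℝ) < m := by linarith
  have h1 := norm_integral_mFourier_mul_signedDiscrepancy_ge x (r := 1 / 4) (by norm_num)
    (by norm_num) hk
  have h2 := norm_integral_mFourier_mul_signedDiscrepancy_ge x (r := 1 / 2) (by norm_num)
    (by norm_num) hk
  rw [← hκ] at h1 h2
  have hpi := Real.pi_pos
  -- For r = 1/4 the argument is u = π|k|/2 ≥ π/2, and r = 1/2 doubles it.
  have hB := chordIntegral_sq_add_sq_ge (u := Real.pi * κ / 2) (by nlinarith)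
  rw [show 2 * Real.pi * κ * (1 / 4) = Real.pi * κ / 2 by ring] at h1
  rw [show 2 * Real.pi * κ * (1 / 2) = 2 * (Real.pi * κ / 2) by ring] at h2
  have hB2 : 1 / 80000 / (m : ℝ) ^ 3 ≤ 1 / 10000 / (Real.pi * κ / 2) ^ 3 := by
    have : (Real.pi * κ / 2) ^ 3 ≤ (2 * m) ^ 3 := by
      have := Real.pi_le_four
      gcongr
      nlinarith
    calc 1 / 80000 / (m : ℝ) ^ 3 = 1 / 10000 / (2 * m) ^ 3 := by
          rw [mul_pow]; field_simp; norm_num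
      _ ≤ _ := by gcongr
  set S := ‖expSum x k‖ ^ 2 with hS
  have hS0 : 0 ≤ S := by positivity
  set X := ‖∫ y, UnitAddTorus.mFourier (-k) y * (signedDiscrepancy x (1 / 4) y : ℂ)‖ ^ 2
  set Y := ‖∫ y, UnitAddTorus.mFourier (-k) y * (signedDiscrepancy x (1 / 2) y : ℂ)‖ ^ 2
  -- The loss of 16 is (4r²)² = 1/16 at r = 1/4; at r = 1/2 that factor is 1.
  have h3 : 1 / 1280000 / (m : ℝ) ^ 3 * S ≤ X + Y := by
    have := mul_le_mul_of_nonneg_right (hB2.trans hB) hS0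
    have e : 1 / 1280000 / (m : ℝ) ^ 3 * S = (1 / 80000 / (m : ℝ) ^ 3 * S) / 16 := by ring
    rw [e]
    nlinarith [mul_nonneg (sq_nonneg (chordIntegral (2 * (Real.pi * κ / 2)))) hS0]
  have h4 := pow_mul_cube_le hN' m
  calc (1 - 1 / (2 * √(N : ℝ))) ^ m * S
      = ((1 - 1 / (2 * √(N : ℝ))) ^ m * (m : ℝ) ^ 3) * (1 / (m : ℝ) ^ 3 * S) := by
        field_simp
    _ ≤ (48 * (N * √N)) * (1 / (m : ℝ) ^ 3 * S) := by gcongr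
    _ = 61440000 * (N * √N) * (1 / 1280000 / (m : ℝ) ^ 3 * S) := by ring
    _ ≤ _ := by gcongr

/-! ### Absorbing the zero frequency and choosing the disk -/

/-- The energy is controlled by mean square discrepancies. -/
theorem rieszEnergy_le {N : ℕ} (hN : 1 ≤ N) (x : Fin N → Torus2) :
    rieszEnergy x ≤ 128 * Real.pi ^ 4 * (81920000 * (N * √N) *
      ((∫ y, signedDiscrepancy x (1 / 4) y ^ 2) + ∫ y, signedDiscrepancy x (1 / 2) y ^ 2)) := by
  have hN' : (1 : ℝ) ≤ N := by exact_mod_cast hN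
  have hs : 1 ≤ √(N : ℝ) := Real.one_le_sqrt.2 hN'
  have hs2 : √(N : ℝ) ^ 2 = N := Real.sq_sqrt (by linarith)
  have hd : 1 / (2 * √(N : ℝ)) ≤ 1 / 2 := by
    rw [div_le_div_iff₀ (by positivity) (by norm_num)]; linarith
  have hd0 : 0 < 1 / (2 * √(N : ℝ)) := by positivity
  set ρ := 1 - 1 / (2 * √(N : ℝ)) with hρ
  have h0 : 0 ≤ ρ := by linarith
  have h1 : ρ < 1 := by linarith
  set F : Torus2 → ℝ := fun y ↦ poissonKer ρ (y 0) * poissonKer ρ (y 1) with hF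
  have hFnn : ∀ y, 0 ≤ F y := fun y ↦
    mul_nonneg (poissonKer_nonneg h0 h1 _) (poissonKer_nonneg h0 h1 _)
  set E := ∑ i, ∑ j, F (x i - x j) with hE
  have hR : rieszEnergy x ≤ 128 * Real.pi ^ 4 * E := by
    rw [rieszEnergy, hE, Finset.mul_sum]
    refine Finset.sum_le_sum fun i _ ↦ ?_
    rw [Finset.mul_sum]
    refine Finset.sum_le_sum fun j _ ↦ ?_
    rw [← torusDist_sub_zero]
    exact poissonKer_mul_ge hN' _
  -- The diagonal bounds the zero-frequency term N² by E/4, which costs a factor 4/3: 81920000 =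
  -- (4/3)·61440000.
  have hdiag : 4 * (N : ℝ) ^ 2 ≤ E := by
    have hp : 2 * √(N : ℝ) ≤ poissonKer ρ 0 := by
      refine le_trans (le_of_eq ?_) (poissonKer_ge h0 h1 0)
      rw [hρ, norm_zero, sub_sub_cancel]
      field_simp
      simp
    have hF0 : 4 * (N : ℝ) ≤ F 0 := by
      have : (2 * √(N : ℝ)) * (2 * √(N : ℝ)) ≤ poissonKer ρ 0 * poissonKer ρ 0 :=
        mul_le_mul hp hp (by positivity) (poissonKer_nonneg h0 h1 0)
      calc 4 * (N : ℝ) = (2 * √(N : ℝ)) * (2 * √(N : ℝ)) := by linear_combination -4 * hs2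
        _ ≤ _ := this
    calc 4 * (N : ℝ) ^ 2 = ∑ _i : Fin N, 4 * (N : ℝ) := by simp; ring
      _ ≤ E := by
        refine Finset.sum_le_sum fun i _ ↦ ?_
        refine le_trans ?_ (Finset.single_le_sum (fun j _ ↦ hFnn (x i - x j)) (Finset.mem_univ i))
        rw [sub_self]; exact hF0
  have hsum := hasSum_le (pow_mul_norm_expSum_sq_le hN x) (hasSum_norm_expSum_sq x h0 h1)
    ((hasSum_ite_eq 0 ((N : ℝ) ^ 2)).add
      (((hasSum_signedDiscrepancy x (1 / 4)).add (hasSum_signedDiscrepancy x (1 / 2))).mul_left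
        (61440000 * (N * √(N : ℝ)))))
  change E ≤ _ at hsum
  refine hR.trans (mul_le_mul_of_nonneg_left ?_ (by positivity))
  linarith

/-- On a probability space a function reaches at least its mean off any given null set. -/
theorem exists_center_sq_signedDiscrepancy_ge {N : ℕ} (x : Fin N → Torus2) {r : ℝ} (hr : 0 < r) :
    ∃ c : Torus2, (∀ i, torusDist c (x i) ≠ r) ∧
      ∫ y, signedDiscrepancy x r y ^ 2 ≤ signedDiscrepancy x r c ^ 2 := by
  have hnull : volume (⋃ i, {c : Torus2 | torusDist c (x i) = r}) = 0 :=
    measure_iUnion_null fun i ↦ volume_torusDist_eq (x i) hr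
  have hint : Integrable (fun y ↦ signedDiscrepancy x r y ^ 2) := by
    refine Integrable.of_bound ((measurable_signedDiscrepancy x r).pow_const 2).aestronglyMeasurable
      ((N : ℝ) ^ 2) (Filter.Eventually.of_forall fun y ↦ ?_)
    rw [norm_pow, Real.norm_eq_abs]
    gcongr
    exact abs_signedDiscrepancy_le x r y
  obtain ⟨c, hc, hle⟩ := exists_notMem_null_integral_le hint hnull
  refine ⟨c, fun i hi ↦ hc (Set.mem_iUnion.2 ⟨i, hi⟩), hle⟩

/-- The constant `C` is absolute. The bound holds for a disk of radius `1/4` or `1/2` whether or not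
its boundary circle is counted as a part of it. -/
theorem corollary1 :
    ∃ C : ℝ, 0 < C ∧ ∀ (N : ℕ), 1 ≤ N → ∀ x : Fin N → Torus2,
      ∃ (c : Torus2) (r : ℝ), (r = 1 / 4 ∨ r = 1 / 2) ∧
        C * Real.sqrt ((N : ℝ) ^ (-(3 / 2) : ℝ) * rieszEnergy x) ≤ discrepancy x (closedDisk c r) ∧
        C * Real.sqrt ((N : ℝ) ^ (-(3 / 2) : ℝ) * rieszEnergy x) ≤ discrepancy x (openDisk c r) := by
  -- The last factor 2 pays for keeping only the larger of the two mean squares.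
  set M : ℝ := 128 * Real.pi ^ 4 * (81920000 * 2) with hM
  have hpi := Real.pi_pos
  have hM0 : 0 < M := by positivity
  refine ⟨1 / √M, by positivity, fun N hN x ↦ ?_⟩
  have hN' : (1 : ℝ) ≤ N := by exact_mod_cast hN
  have hs : 0 < √(N : ℝ) := Real.sqrt_pos.2 (by linarith)
  have hpow : (N : ℝ) ^ (-(3 / 2) : ℝ) * (N * √N) = 1 := by
    have : (N : ℝ) * √N = (N : ℝ) ^ ((3 : ℝ) / 2) := by
      rw [Real.sqrt_eq_rpow, ← Real.rpow_one_add' (by linarith) (by norm_num)]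
      norm_num
    rw [this, ← Real.rpow_add (by linarith)]
    norm_num
  have hE := rieszEnergy_le hN x
  set I₁ := ∫ y, signedDiscrepancy x (1 / 4) y ^ 2
  set I₂ := ∫ y, signedDiscrepancy x (1 / 2) y ^ 2
  have hfin : ∀ r : ℝ, 0 < r → I₁ + I₂ ≤ 2 * ∫ y, signedDiscrepancy x r y ^ 2 → ∃ c : Torus2,
      1 / √M * Real.sqrt ((N : ℝ) ^ (-(3 / 2) : ℝ) * rieszEnergy x)
        ≤ discrepancy x (closedDisk c r) ∧
      1 / √M * Real.sqrt ((N : ℝ) ^ (-(3 / 2) : ℝ) * rieszEnergy x)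
        ≤ discrepancy x (openDisk c r) := by
    intro r hr hI
    obtain ⟨c, hc, hle⟩ := exists_center_sq_signedDiscrepancy_ge x hr
    refine ⟨c, ?_⟩
    rw [discrepancy_closedDisk x hr hc, and_self, discrepancy_openDisk, one_div_mul_eq_div,
      ← Real.sqrt_div' _ hM0.le, Real.sqrt_le_iff, sq_abs]
    refine ⟨abs_nonneg _, ?_⟩
    rw [div_le_iff₀ hM0]
    calc (N : ℝ) ^ (-(3 / 2) : ℝ) * rieszEnergy x
        ≤ (N : ℝ) ^ (-(3 / 2) : ℝ) *
            (128 * Real.pi ^ 4 * (81920000 * (N * √N) * (2 * signedDiscrepancy x r c ^ 2))) := by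
          gcongr
          refine hE.trans ?_
          gcongr
          linarith
      _ = ((N : ℝ) ^ (-(3 / 2) : ℝ) * (N * √N)) * (signedDiscrepancy x r c ^ 2 * M) := by
          rw [hM]; ring
      _ = _ := by rw [hpow, one_mul]
  rcases le_total I₁ I₂ with h | h
  · obtain ⟨c, hc⟩ := hfin (1 / 2) (by norm_num) (by change _ ≤ 2 * I₂; linarith)
    exact ⟨c, 1 / 2, Or.inr rfl, hc⟩
  · obtain ⟨c, hc⟩ := hfin (1 / 4) (by norm_num) (by change _ ≤ 2 * I₁; linarith)
    exact ⟨c, 1 / 4, Or.inl rfl, hc⟩
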